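/- Lemma 4.2. Let $t\ge 0$ be an integer and let $G$ be a group that has a presentation with at most $t+1$ generators and at most $2t$ relators, each a word of length at most $3$ in the generators and their inverses. For a representation $\rho:G\to \mathrm{PSL}(2,\mathbb C)$ let $\chi_\rho:G\to\mathbb C$, $\chi_\rho(g)=(\operatorname{tr}\rho(g))^2$, be its character. The $\mathrm{PSL}(2,\mathbb C)$ character variety of $G$ is the set $\{\chi_\rho \mid \rho:G\to\mathrm{PSL}(2,\mathbb C)\}$ of all characters, with the Zariski topology: its closed subsets are those cut out by polynomials in the coordinate functions $\chi\mapsto\chi(g)$, $g\in G$. A subgroup of $\mathrm{PSL}(2,\mathbb C)$ is elementary if its action by Möbius transformations on the Riemann sphere $\mathbb C\cup\{\infty\}$ has at least one point with finite orbit, and non-elementary otherwise. The trace field of a subgroup $H$ of $\mathrm{PSL}(2,\mathbb C)$ is $\mathbb Q(\operatorname{tr}(h): h\in H)$ (each trace being defined up to sign). Let $X$ be an irreducible component of dimension $0$ of the $\mathrm{PSL}(2,\mathbb C)$ character variety of $G$ such that $\rho(G)$ is non-elementary for every representation $\rho:G\to\mathrm{PSL}(2,\mathbb C)$ with $\chi_\rho\in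 X$. Then for every representation $\rho:G\to\mathrm{PSL}(2,\mathbb C)$ with $\chi_\rho\in X$, the trace field of $\rho(G)$ is a finite extension of $\mathbb Q$ and $$[\mathbb Q(\operatorname{tr}(h):h\in\rho(G)):\mathbb Q]\ \le\ 2^{t-1}3^{6t}.$$ -/

import Mathlib

open scoped MatrixGroups

noncomputable section

/-- The group `G` has a presentation with at most `n` generators and at most `m` relators, each
a word of length at most `l` in the generators and their inverses. -/
def HasPresentationBounds (G : Type*) [Group G] (n m l : ℕ) : Prop :=
  ∃ k ≤ n, ∃ rels : Finset (FreeGroup (Fin k)), rels.card ≤ m ∧ (∀ r ∈ rels, r.norm ≤ l) ∧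
    Nonempty (PresentedGroup (rels : Set (FreeGroup (Fin k))) ≃* G)

/-- The class `± A` in `PSL(2, ℂ)` of a matrix `A` in `SL(2, ℂ)`. -/
def toPSL : SL(2, ℂ) →* PSL(2, ℂ) :=
  QuotientGroup.mk' (Subgroup.center SL(2, ℂ))

/-- The squared trace `tr(A)²` takes the same value on all lifts of an element of `PSL(2, ℂ)`. -/
theorem sq_trace_eq_of_leftRel (A B : SL(2, ℂ))
    (h : (QuotientGroup.leftRel (Subgroup.center SL(2, ℂ))) A B) :
    A.val.trace ^ 2 = B.val.trace ^ 2 := by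
  rw [QuotientGroup.leftRel_apply] at h
  obtain ⟨r, hr, hs⟩ := Matrix.SpecialLinearGroup.mem_center_iff.mp h
  have hB : B = A * (A⁻¹ * B) := by group
  have hB' : B.val = A.val * (A⁻¹ * B).val := by
    conv_lhs => rw [hB]
    rfl
  rw [hB', ← hs, Matrix.scalar_apply]
  have hr2 : r ^ 2 = 1 := by simpa using hr
  simp only [Matrix.trace_fin_two, Matrix.mul_diagonal]
  linear_combination (-(A.val 0 0 + A.val 1 1) ^ 2) * hr2

/-- The squared trace on `PSL(2, ℂ)`: `± A ↦ tr(A)²`. -/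
def sqTrace : PSL(2, ℂ) → ℂ :=
  Quotient.lift (fun A : SL(2, ℂ) => A.val.trace ^ 2) sq_trace_eq_of_leftRel

/-- The character `χ_ρ : G → ℂ`, `χ_ρ(g) = tr(ρ(g))²`, of a representation
`ρ : G → PSL(2, ℂ)`. -/
def pslCharacter {G : Type*} [Group G] (ρ : G →* PSL(2, ℂ)) : G → ℂ :=
  fun g => sqTrace (ρ g)

/-- The `PSL(2, ℂ)` character variety of `G`: the set of all characters `χ_ρ` of
representations `ρ : G → PSL(2, ℂ)`. -/
def PSLCharacterVariety (G : Type*) [Group G] : Type _ :=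
  {χ : G → ℂ // ∃ ρ : G →* PSL(2, ℂ), χ = pslCharacter ρ}

namespace PSLCharacterVariety

variable {G : Type*} [Group G]

/-- The point `χ_ρ` of the character variety. -/
def ofRep (ρ : G →* PSL(2, ℂ)) : PSLCharacterVariety G :=
  ⟨pslCharacter ρ, ρ, rfl⟩

/-- The algebraic subset of the character variety cut out by a set `S` of polynomials in the
coordinate functions `χ ↦ χ(g)`, `g ∈ G`. -/
def zeroSet (S : Set (MvPolynomial G ℂ)) : Set (PSLCharacterVariety G) :=
  {χ | ∀ p ∈ S, MvPolynomial.eval χ.1 p = 0}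

/-- The Zariski topology on the character variety: the closed sets are the algebraic subsets. -/
instance : TopologicalSpace (PSLCharacterVariety G) :=
  TopologicalSpace.ofClosed (Set.range zeroSet)
    ⟨Set.univ, Set.eq_empty_of_forall_notMem fun χ hχ => by simpa using hχ 1 trivial⟩
    (by
      intro A hA
      refine ⟨{p | ∃ S, zeroSet S ∈ A ∧ p ∈ S}, ?_⟩
      ext χ
      constructor
      · intro hχ Z hZ
        obtain ⟨S, rfl⟩ := hA hZ
        exact fun p hp => hχ p ⟨S, hZ, hp⟩
      · rintro hχ p ⟨S, hS, hp⟩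
        exact hχ _ hS p hp)
    (by
      rintro _ ⟨S, rfl⟩ _ ⟨T, rfl⟩
      refine ⟨{p | ∃ a ∈ S, ∃ b ∈ T, p = a * b}, ?_⟩
      ext χ
      constructor
      · intro hχ
        by_contra hcon
        simp only [Set.mem_union, not_or, zeroSet, Set.mem_ofPred_eq, not_forall] at hcon
        obtain ⟨⟨a, ha, ha'⟩, b, hb, hb'⟩ := hcon
        have := hχ _ ⟨a, ha, b, hb, rfl⟩
        rw [map_mul, mul_eq_zero] at this
        exact this.elim ha' hb'
      · rintro (h | h) _ ⟨a, ha, b, hb, rfl⟩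
        · rw [map_mul, h a ha, zero_mul]
        · rw [map_mul, h b hb, mul_zero])

theorem isClosed_iff (Z : Set (PSLCharacterVariety G)) :
    IsClosed Z ↔ ∃ S : Set (MvPolynomial G ℂ), Z = zeroSet S := by
  rw [← isOpen_compl_iff]
  change Zᶜᶜ ∈ Set.range zeroSet ↔ _
  rw [compl_compl]
  exact ⟨fun ⟨S, h⟩ => ⟨S, h.symm⟩, fun ⟨S, h⟩ => ⟨S, h.symm⟩⟩

end PSLCharacterVariety

/-- The orbit of a point `z` of the Riemann sphere `ℂ ∪ {∞}` under a subgroup `H` of `PSL(2, ℂ)`,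
which acts by Möbius transformations. -/
def pslOrbit (H : Subgroup PSL(2, ℂ)) (z : OnePoint ℂ) : Set (OnePoint ℂ) :=
  {w | ∃ A : SL(2, ℂ), toPSL A ∈ H ∧ w = (A : GL (Fin 2) ℂ) • z}

/-- A subgroup of `PSL(2, ℂ)` is elementary if it has a finite orbit on the Riemann sphere. -/
def IsElementary (H : Subgroup PSL(2, ℂ)) : Prop :=
  ∃ z : OnePoint ℂ, (pslOrbit H z).Finite

/-- The trace field `ℚ(tr(h) : h ∈ H)` of a subgroup `H` of `PSL(2, ℂ)`. The trace of an element
is defined up to sign; both signs are adjoined, which does not affect the field. -/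
def traceField (H : Subgroup PSL(2, ℂ)) : IntermediateField ℚ ℂ :=
  IntermediateField.adjoin ℚ {x | ∃ A : SL(2, ℂ), toPSL A ∈ H ∧ x = A.val.trace}

end

noncomputable section

/-! Lift `ρ` on `n ≤ t + 1` generators to matrices in `SL(2, ℂ)`; relators go to fixed signs. A
relator of length three is written `u = ± v⁻¹` with `u` of length at most two and `v` of length at
most one, so the lifts are cut out by polynomials over `ℚ` of degree at most 2 in the `4 * n` matrix
entries. Let `P` be a minimal prime over these equations that vanishes at the lift, and `B` the
quotient by `P`.

Since `X` is a single point, squared traces are constant along a component of `ℂ ⊗ B` through the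
lift. This forces the generic traces in `B` to be algebraic over `ℚ`
(`isAlgebraic_trace_of_isolated`), so the trace field is the image of algebraic elements of `B`.

A Bézout bound (`MvPolynomial.card_le_pow_of_mem_minimalPrimes`) allows at most `2 ^ (4 * n)`
linearly independent such elements. Its proof makes `P` minimal over as few equations `f i` as
possible. These are then analytically independent at `P`; together with coordinates forming a
transcendence basis modulo `P` they are at least as many as the variables, and monomials in them
times lifts of the algebraic elements stay linearly independent. Counting dimensions in growing
degree gives the bound.

For `t ≥ 1`, `16 ^ (t + 1)` is below the claimed bound; for `t = 0` the group is cyclic and `ρ` is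
elementary. -/

/-! ### Analytic independence at a minimal prime -/

open MvPolynomial in
/-- Evaluating a polynomial along the line spanned by `l`: the lowest order term is given by
the initial form. -/
theorem exists_eval_smul_eq_pow_mul {τ A : Type*} [CommRing A] (P : Ideal A)
    (c : MvPolynomial τ A) (m : ℕ) (hm : ∀ α ∈ c.support, m ≤ α.degree) (l : τ → A) (u : A)
    (hu : u ∈ P) :
    ∃ g : A, g - eval l (homogeneousComponent m c) ∈ P ∧
      eval (fun i => l i * u) c = u ^ m * g := by
  classical
  refine ⟨∑ α ∈ c.support, c.coeff α * (∏ i ∈ α.support, l i ^ α i) * u ^ (α.degree - m), ?_, ?_⟩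
  · rw [homogeneousComponent_apply, map_sum, Finset.sum_filter, ← Finset.sum_sub_distrib]
    refine P.sum_mem fun α hα => ?_
    split_ifs with h
    · simp [eval_monomial, h, Finsupp.prod]
    · have : α.degree - m ≠ 0 := by have := hm α hα; omega
      rw [sub_zero]
      exact P.mul_mem_left _ (P.pow_mem_of_mem hu _ (Nat.pos_of_ne_zero this))
  · rw [eval_eq, Finset.mul_sum]
    refine Finset.sum_congr rfl fun α hα => ?_
    have h1 : u ^ α.degree = u ^ m * u ^ (α.degree - m) := by
      rw [← pow_add, Nat.add_sub_cancel' (hm α hα)]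
    have h2 : ∏ i ∈ α.support, (l i * u) ^ α i = (∏ i ∈ α.support, l i ^ α i) * u ^ α.degree := by
      simp_rw [mul_pow, Finset.prod_mul_distrib, Finsupp.degree_apply, Finset.prod_pow_eq_pow_sum]
    rw [h2, h1]
    ring

open MvPolynomial in
theorem eval_sub_eval_mem {τ A : Type*} [CommRing A] (J : Ideal A) (x y : τ → A)
    (h : ∀ i, x i - y i ∈ J) (c : MvPolynomial τ A) : eval x c - eval y c ∈ J := by
  have hxy : Ideal.Quotient.mk J ∘ x = Ideal.Quotient.mk J ∘ y :=
    funext fun i => Ideal.Quotient.eq.mpr (h i)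
  have hx := eval₂_comp (Ideal.Quotient.mk J) x c
  have hy := eval₂_comp (Ideal.Quotient.mk J) y c
  exact Ideal.Quotient.eq.mp (hx.trans ((congrArg (fun z => eval₂ (Ideal.Quotient.mk J) z c)
    hxy).trans hy.symm))

open MvPolynomial in
/-- If `P` is a minimal prime over `h` elements of a vector space `W`, and `h` is least possible,
then these elements are analytically independent at `P`. -/
theorem eq_zero_of_eval_eq_zero_of_minimal {k A : Type*} [Field k] [Infinite k] [CommRing A]
    [Algebra k A] {P : Ideal A} [P.IsPrime] (W : Submodule k A) {h : ℕ} (f : Fin h → A)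
    (hf : ∀ i, f i ∈ W) (hP : P ∈ (Ideal.span (Set.range f)).minimalPrimes)
    (hmin : ∀ h' < h, ∀ f' : Fin h' → A, (∀ i, f' i ∈ W) →
      P ∉ (Ideal.span (Set.range f')).minimalPrimes)
    (c : MvPolynomial (Fin h) A) (hc : ∀ α, c.coeff α ∈ P → c.coeff α = 0)
    (h0 : eval f c = 0) : c = 0 := by
  classical
  by_contra hne
  have hfP : ∀ i, f i ∈ P := fun i => hP.1.2 (Ideal.subset_span ⟨i, rfl⟩)
  obtain ⟨α₀, hα₀, hmin₀⟩ := Finset.exists_min_image c.support Finsupp.degree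
    (support_nonempty.mpr hne)
  set m := Finsupp.degree α₀ with hm
  set F := homogeneousComponent m c with hF
  have hFne : map (Ideal.Quotient.mk P) F ≠ 0 := by
    intro h
    have h1 := congrArg (coeff α₀) h
    rw [coeff_map, coeff_homogeneousComponent, if_pos hm.symm, coeff_zero,
      Ideal.Quotient.eq_zero_iff_mem] at h1
    exact (mem_support_iff.mp hα₀) (hc _ h1)
  -- The initial form is nonzero over the domain `A ⧸ P`, in which the image of `k` is infinite, so
  -- it cannot vanish at every point with coordinates in `k`.
  obtain ⟨l, hl⟩ : ∃ l : Fin h → k, eval (fun i => algebraMap k A (l i)) F ∉ P := by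
    by_contra! hcon
    refine hFne (funext_set (fun _ => Set.range (algebraMap k (A ⧸ P)))
      (fun _ => Set.infinite_range_of_injective (algebraMap k (A ⧸ P)).injective) fun x hx => ?_)
    choose l hl using fun i => hx i trivial
    have : x = fun i => Ideal.Quotient.mk P (algebraMap k A (l i)) := funext fun i => (hl i).symm
    rw [map_zero, this, eval_map, ← Ideal.Quotient.eq_zero_iff_mem.mpr (hcon l)]
    exact (eval₂_comp (Ideal.Quotient.mk P) (fun i => algebraMap k A (l i)) F).symm
  obtain ⟨i₀, hi₀⟩ | hl0 : (∃ i, l i ≠ 0) ∨ ∀ i, l i = 0 := by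
    by_cases h : ∃ i, l i ≠ 0
    · exact Or.inl h
    · exact Or.inr (by simpa using h)
  · obtain ⟨h', rfl⟩ : ∃ h', h = h' + 1 := ⟨h - 1, by have := i₀.pos; omega⟩
    set u := (l i₀)⁻¹ • f i₀ with hu
    have huW : u ∈ W := W.smul_mem _ (hf i₀)
    have huP : u ∈ P := by rw [hu, Algebra.smul_def]; exact P.mul_mem_left _ (hfP i₀)
    -- Modulo the `h - 1` elements `f'`, every `f i` becomes `l i * u`. The relation `c` then reads
    -- `u ^ m * g = 0` with `g ∉ P`, so a prime inside `P` containing `f'` contains `u`, hence all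
    -- `f i`: `P` is minimal over fewer elements.
    set f' : Fin h' → A := fun j => f (i₀.succAbove j) - l (i₀.succAbove j) • u with hf'
    obtain ⟨g, hgP, hg⟩ := exists_eval_smul_eq_pow_mul P c m hmin₀ (fun i => algebraMap k A (l i))
      u huP
    have hgP' : g ∉ P := fun h => hl (by simpa using P.sub_mem h hgP)
    have hJ : ∀ i, f i - algebraMap k A (l i) * u ∈ Ideal.span (Set.range f') := by
      intro i
      rcases Fin.eq_self_or_eq_succAbove i₀ i with rfl | ⟨j, rfl⟩
      · rw [hu, ← Algebra.smul_def, smul_smul, mul_inv_cancel₀ hi₀, one_smul, sub_self]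
        exact zero_mem _
      · rw [← Algebra.smul_def]
        exact Ideal.subset_span ⟨j, rfl⟩
    have hmem : u ^ m * g ∈ Ideal.span (Set.range f') := by
      have := eval_sub_eval_mem (Ideal.span (Set.range f')) f _ hJ c
      rwa [h0, zero_sub, neg_mem_iff, hg] at this
    refine hmin h' (Nat.lt_succ_self _) f' (fun j => W.sub_mem (hf _) (W.smul_mem _ huW)) ?_
    refine ⟨⟨inferInstance, ?_⟩, ?_⟩
    · rw [Ideal.span_le]
      rintro _ ⟨j, rfl⟩
      refine P.sub_mem (hfP _) ?_
      rw [Algebra.smul_def]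
      exact P.mul_mem_left _ huP
    · rintro Q ⟨hQ, hQJ⟩ hQP
      refine hP.2 ⟨hQ, ?_⟩ hQP
      have huQ : u ∈ Q := by
        rcases hQ.mem_or_mem (hQJ hmem) with h | h
        · exact hQ.mem_of_pow_mem _ h
        · exact absurd (hQP h) hgP'
      rw [Ideal.span_le]
      rintro _ ⟨i, rfl⟩
      have := Q.add_mem (hQJ (hJ i)) (Q.mul_mem_left (algebraMap k A (l i)) huQ)
      simpa using this
  -- With `l = 0` (in particular for `h = 0`) the initial form must be a constant outside `P`, which
  -- the relation forbids because all `f i` lie in `P`.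
  · obtain ⟨g, hgP, hg⟩ := exists_eval_smul_eq_pow_mul P c m hmin₀ (fun i => algebraMap k A (l i))
      0 P.zero_mem
    have hgP' : g ∉ P := fun h => hl (by simpa using P.sub_mem h hgP)
    have hm0 : m = 0 := by
      by_contra hm0
      refine hl ?_
      have : (fun i => algebraMap k A (l i)) = 0 := funext fun i => by simp [hl0]
      rw [this, eval_zero, constantCoeff_eq, hF, coeff_homogeneousComponent, map_zero,
        if_neg (Ne.symm hm0)]
      exact P.zero_mem
    have := eval_sub_eval_mem P f (fun i => algebraMap k A (l i) * 0) (by simpa using hfP) c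
    rw [h0, zero_sub, neg_mem_iff, hg, hm0, pow_zero, one_mul] at this
    exact hgP' this

/-- A vanishing combination is read as a polynomial relation `c` among the `f i`. Its coefficients
are combinations of the `b i`, so by independence modulo `P` a coefficient lying in `P` has all its
scalars zero. This is exactly what analytic independence needs to give `c = 0`. -/
theorem linearIndependent_prod_pow_mul {k A : Type*} [Field k] [Infinite k] [CommRing A]
    [Algebra k A] {P : Ideal A} [P.IsPrime] (W : Submodule k A) {h : ℕ} (f : Fin h → A)
    (hf : ∀ i, f i ∈ W) (hP : P ∈ (Ideal.span (Set.range f)).minimalPrimes)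
    (hmin : ∀ h' < h, ∀ f' : Fin h' → A, (∀ i, f' i ∈ W) →
      P ∉ (Ideal.span (Set.range f')).minimalPrimes)
    {I : Type*} (b : I → A) (hb : LinearIndependent k fun i => Ideal.Quotient.mk P (b i)) :
    LinearIndependent k fun x : (Fin h →₀ ℕ) × I => (x.1.prod fun i e => f i ^ e) * b x.2 := by
  classical
  rw [linearIndependent_iff']
  intro s g hg
  set c : MvPolynomial (Fin h) A :=
    ∑ x ∈ s, MvPolynomial.monomial x.1 (g x • b x.2) with hc
  have hcoeff : ∀ α, c.coeff α = ∑ x ∈ s with x.1 = α, g x • b x.2 := by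
    intro α
    rw [hc, MvPolynomial.coeff_sum, Finset.sum_filter]
    simp only [MvPolynomial.coeff_monomial]
  have key : ∀ α, c.coeff α ∈ P → ∀ x ∈ s, x.1 = α → g x = 0 := by
    intro α hα
    rw [hcoeff, ← Ideal.Quotient.eq_zero_iff_mem, map_sum] at hα
    have hli : LinearIndepOn k (fun x : (Fin h →₀ ℕ) × I => Ideal.Quotient.mk P (b x.2))
        {x | x.1 = α} := by
      refine hb.comp (fun x : {x : (Fin h →₀ ℕ) × I | x.1 = α} => x.1.2) ?_
      rintro ⟨⟨a, i⟩, h₁⟩ ⟨⟨a', i'⟩, h₂⟩ h₃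
      exact Subtype.ext (Prod.ext (h₁.trans h₂.symm) h₃)
    intro x hx hxα
    exact linearIndepOn_iff'.mp hli (s.filter fun x => x.1 = α) g (by intro; simp) hα x
      (by simp [hx, hxα])
  have hc0 : c = 0 := by
    refine eq_zero_of_eval_eq_zero_of_minimal W f hf hP hmin c (fun α hα => ?_) ?_
    · rw [hcoeff]
      refine Finset.sum_eq_zero fun x hx => ?_
      rw [Finset.mem_filter] at hx
      rw [key α hα x hx.1 hx.2, zero_smul]
    · rw [← hg, hc, map_sum]
      refine Finset.sum_congr rfl fun x _ => ?_
      rw [MvPolynomial.eval_monomial, smul_mul_assoc, mul_comm]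
  intro x hx
  exact key x.1 (by simp [hc0]) x hx rfl

/-! ### Transcendence bases and the dimension inequality -/

/-- Products of an algebraically independent family and a linearly independent family of algebraic
elements are linearly independent. -/
theorem linearIndependent_mul_prod_pow_of_isAlgebraic {k D I ι : Type*} [Field k] [CommRing D]
    [IsDomain D] [Algebra k D] (y : I → D) (hy : AlgebraicIndependent k y) (e : ι → D)
    (he : LinearIndependent k e) (halg : ∀ i, IsAlgebraic k (e i)) :
    LinearIndependent k fun x : (I →₀ ℕ) × ι => (x.1.prod fun i n => y i ^ n) * e x.2 := by
  classical
  -- Algebraic independence persists over the integral closure of `k`, which contains the `e i`; the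
  -- claim is then the product of independent families in a tower.
  have hy' : AlgebraicIndependent (integralClosure k D) y := hy.integralClosure
  let e' : ι → integralClosure k D := fun i => ⟨e i, (halg i).isIntegral⟩
  have he' : LinearIndependent k e' := by
    refine LinearIndependent.of_comp (integralClosure k D).val.toLinearMap ?_
    exact he
  have hmon := (MvPolynomial.basisMonomials I (integralClosure k D)).linearIndependent.map'
    (MvPolynomial.aeval y).toLinearMap (LinearMap.ker_eq_bot.mpr hy')
  have h := (linearIndependent_smul he' hmon).comp Prod.swap Prod.swap_injective
  have hfun : (fun x : (I →₀ ℕ) × ι => (x.1.prod fun i n => y i ^ n) * e x.2) =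
      (fun p : ι × (I →₀ ℕ) => e' p.1 • ((MvPolynomial.aeval y).toLinearMap ∘
        MvPolynomial.basisMonomials I (integralClosure k D)) p.2) ∘ Prod.swap := by
    funext x
    simp [MvPolynomial.aeval_monomial, e', Subalgebra.smul_def, mul_comm]
  rw [hfun]
  exact h

-- With `p` the contraction of `P`, going down gives `p[X]` at least the height of `p`. If `P =
-- p[X]`, the quotient is a polynomial ring and gains a transcendental; otherwise `P` is strictly
-- larger than the prime `p[X]` and gains height.
open Polynomial in
theorem Polynomial.height_comap_C_add_trdeg_add_one_le {k R : Type*} [Field k] [CommRing R]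
    [IsNoetherianRing R] [Algebra k R] (P : Ideal (Polynomial R)) [P.IsPrime] :
    (P.comap Polynomial.C).height + (Algebra.trdeg k (R ⧸ P.comap Polynomial.C)).toENat + 1 ≤
      P.height + (Algebra.trdeg k (Polynomial R ⧸ P)).toENat := by
  set p := P.comap Polynomial.C with hp
  have hpp : p.IsPrime := inferInstance
  have hle : p.map Polynomial.C ≤ P := Ideal.map_comap_le
  have hpr : (p.map Polynomial.C).IsPrime := Ideal.isPrime_map_C_of_isPrime
  have hlies : (p.map Polynomial.C).LiesOver p := ⟨by
    refine le_antisymm Ideal.le_comap_map fun x hx => ?_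
    exact hle hx⟩
  have hht : p.height ≤ (p.map Polynomial.C).height := by
    rw [Ideal.height_eq_height_add_of_liesOver_of_hasGoingDown p (p.map Polynomial.C)]
    exact le_self_add
  rcases eq_or_lt_of_le hle with h | h
  · have htr : Algebra.trdeg k (R ⧸ p) + 1 ≤ Algebra.trdeg k (Polynomial R ⧸ P) := by
      rw [← Polynomial.trdeg_of_isDomain (R := R ⧸ p),
        trdeg_add_eq k (R ⧸ p) (A := Polynomial (R ⧸ p))]
      have e : Polynomial (R ⧸ p) ≃ₐ[k] (Polynomial R ⧸ P) :=
        (AlgEquiv.ofRingEquiv (f := Ideal.polynomialQuotientEquivQuotientPolynomial p)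
          (fun r => by
            rw [IsScalarTower.algebraMap_apply k R (R ⧸ p)[X],
              IsScalarTower.algebraMap_apply R (R ⧸ p) (R ⧸ p)[X]]
            have := Ideal.polynomialQuotientEquivQuotientPolynomial_map_mk p (C (algebraMap k R r))
            rw [map_C] at this
            exact this)).trans (Ideal.quotientEquivAlgOfEq k h)
      exact trdeg_le_of_injective e.toAlgHom e.injective
    rw [add_assoc]
    refine add_le_add (hht.trans (Ideal.height_mono hle)) ?_
    simpa using Cardinal.toENat.monotone' htr
  · have htr : Algebra.trdeg k (R ⧸ p) ≤ Algebra.trdeg k (Polynomial R ⧸ P) := by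
      let φ : (R ⧸ p) →ₐ[k] (Polynomial R ⧸ P) :=
        Ideal.quotientMapₐ P (IsScalarTower.toAlgHom k R (Polynomial R)) le_rfl
      exact trdeg_le_of_injective φ Ideal.quotientMap_injective
    rw [add_right_comm]
    refine add_le_add ((add_le_add_left hht 1).trans
      (Ideal.height_add_one_le_of_lt_of_isPrime h)) ?_
    exact Cardinal.toENat.monotone' htr

theorem MvPolynomial.natCard_le_height_add_trdeg {σ k : Type*} [Finite σ] [Field k]
    (P : Ideal (MvPolynomial σ k)) [P.IsPrime] :
    (Nat.card σ : ℕ∞) ≤ P.height + (Algebra.trdeg k (MvPolynomial σ k ⧸ P)).toENat := by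
  induction σ using Finite.induction_empty_option with
  | @of_equiv α β e ih =>
    let E := MvPolynomial.renameEquiv k e
    have h1 := ih (P.comap E)
    have h2 : (P.comap E).height = P.height := E.toRingEquiv.height_comap P
    let E' : (MvPolynomial α k ⧸ P.comap E) ≃ₐ[k] (MvPolynomial β k ⧸ P) :=
      Ideal.quotientEquivAlg _ _ E (Ideal.map_comap_of_surjective _ E.surjective P).symm
    have h3 := E'.lift_trdeg_eq
    rw [h2, Nat.card_congr e] at h1
    refine h1.trans (add_le_add le_rfl ?_)
    have := congrArg Cardinal.toENat h3
    simpa using this.le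
  | h_empty => simp
  | @h_option α _ ih =>
    let E := MvPolynomial.optionEquivLeft k α
    have h0 := Polynomial.height_comap_C_add_trdeg_add_one_le (k := k) (P.comap E.symm)
    have h1 := ih ((P.comap E.symm).comap Polynomial.C)
    have h2 : (P.comap E.symm).height = P.height := E.symm.toRingEquiv.height_comap P
    let E' : (Polynomial (MvPolynomial α k) ⧸ P.comap E.symm) ≃ₐ[k]
        (MvPolynomial (Option α) k ⧸ P) :=
      Ideal.quotientEquivAlg _ _ E.symm (Ideal.map_comap_of_surjective _ E.symm.surjective P).symm
    have h3 := AlgEquiv.lift_trdeg_eq (A := Polynomial (MvPolynomial α k) ⧸ P.comap E.symm) E'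
    have h4 := congrArg Cardinal.toENat h3
    simp only [Cardinal.toENat_lift] at h4
    rw [h2, h4] at h0
    refine le_trans ?_ h0
    rw [Finite.card_option, Nat.cast_add, Nat.cast_one]
    exact add_le_add_left h1 1

/-! ### Counting monomials and the Bézout bound -/

/-- The exponents of the monomials of total degree at most `M`. -/
def exponentsOfDegreeLE (σ : Type*) [Fintype σ] [DecidableEq σ] (M : ℕ) : Finset (σ →₀ ℕ) :=
  (Finset.range (M + 1)).biUnion fun m => Finset.univ.finsuppAntidiag m

theorem mem_exponentsOfDegreeLE {σ : Type*} [Fintype σ] [DecidableEq σ] {M : ℕ} {α : σ →₀ ℕ} :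
    α ∈ exponentsOfDegreeLE σ M ↔ α.degree ≤ M := by
  simp [exponentsOfDegreeLE, Finset.mem_finsuppAntidiag, Finsupp.degree_eq_sum]

theorem card_exponentsOfDegreeLE (σ : Type*) [Fintype σ] [DecidableEq σ] (M : ℕ) :
    (exponentsOfDegreeLE σ M).card = (M + Fintype.card σ).choose (Fintype.card σ) := by
  have h1 : (exponentsOfDegreeLE σ M).card =
      ∑ m ∈ Finset.range (M + 1), (Fintype.card σ).multichoose m := by
    rw [exponentsOfDegreeLE, Finset.card_biUnion]
    · simp [Finset.card_finsuppAntidiag_nat_eq_multichoose]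
    · intro a _ b _ hab
      refine Finset.disjoint_left.mpr fun α ha hb => ?_
      exact hab ((Finset.mem_finsuppAntidiag.mp ha).1.symm.trans
        (Finset.mem_finsuppAntidiag.mp hb).1)
  have h2 : ∀ n M : ℕ, ∑ m ∈ Finset.range (M + 1), n.multichoose m = (n + 1).multichoose M := by
    intro n M
    induction M with
    | zero => simp
    | succ M ih => rw [Finset.sum_range_succ, ih, Nat.multichoose_succ_succ, add_comm]
  rw [h1, h2, Nat.multichoose_eq, Nat.choose_symm_of_eq_add (b := Fintype.card σ) (by omega)]
  congr 1
  omega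

/-- Both sides are polynomials in `M` of degree `n`, with leading coefficients `D / n!` and `d ^ n /
n!`. Crude bounds on the binomials reduce this to `D ≤ ((d * M + c + n) / (M + 1)) ^ n`, whose right
side tends to `d ^ n`. -/
theorem le_pow_of_forall_mul_choose_le (D d c n : ℕ)
    (h : ∀ M : ℕ, D * (M + n).choose n ≤ (d * M + c + n).choose n) : D ≤ d ^ n := by
  have hlim : Filter.Tendsto (fun M : ℕ => ((d : ℝ) + ((c : ℝ) + n - d) * (1 / ((M : ℝ) + 1))) ^ n)
      Filter.atTop (nhds ((d : ℝ) ^ n)) := by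
    have := (tendsto_one_div_add_atTop_nhds_zero_nat (𝕜 := ℝ)).const_mul ((c : ℝ) + n - d)
    have := (this.const_add (d : ℝ)).pow n
    simpa using this
  have : (D : ℝ) ≤ (d : ℝ) ^ n := by
    refine ge_of_tendsto hlim (Filter.Eventually.of_forall fun M => ?_)
    have hM : (0 : ℝ) < (M : ℝ) + 1 := by positivity
    have h1 : (D : ℝ) * (M + n).choose n ≤ (d * M + c + n).choose n := by exact_mod_cast h M
    have h2 := Nat.pow_le_choose (α := ℝ) n (M + n)
    have h3 := Nat.choose_le_pow_div (α := ℝ) n (d * M + c + n)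
    have hf : (0 : ℝ) < (n.factorial : ℝ) := by positivity
    rw [show M + n + 1 - n = M + 1 by omega, div_le_iff₀ hf] at h2
    rw [le_div_iff₀ hf] at h3
    have h4 : (D : ℝ) * ((M : ℝ) + 1) ^ n ≤ ((d : ℝ) * M + c + n) ^ n := by
      calc (D : ℝ) * ((M : ℝ) + 1) ^ n
          ≤ D * ((M + n).choose n * n.factorial) := by
            refine mul_le_mul_of_nonneg_left ?_ (Nat.cast_nonneg _)
            exact_mod_cast h2
        _ = D * (M + n).choose n * n.factorial := by ring
        _ ≤ (d * M + c + n).choose n * n.factorial := by gcongr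
        _ ≤ _ := by exact_mod_cast h3
    rw [← le_div_iff₀ (pow_pos hM n), ← div_pow] at h4
    refine h4.trans (le_of_eq ?_)
    congr 1
    field_simp
    ring
  exact_mod_cast this

/-- If the monomials in polynomials `g i` of degree at most `d`, one for each variable, multiplied
with the elements of a family `e` are linearly independent, then `e` has at most `d ^ n` members,
where `n` is the number of variables. -/
theorem MvPolynomial.card_le_pow_of_linearIndependent {σ k ι : Type*} [Fintype σ] [Field k]
    [Fintype ι] (d : ℕ) (g : σ → MvPolynomial σ k) (hg : ∀ i, (g i).totalDegree ≤ d)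
    (e : ι → MvPolynomial σ k)
    (hli : LinearIndependent k fun x : (σ →₀ ℕ) × ι => (x.1.prod fun i n => g i ^ n) * e x.2) :
    Fintype.card ι ≤ d ^ Fintype.card σ := by
  classical
  obtain ⟨c, hc⟩ : ∃ c, ∀ j, (e j).totalDegree ≤ c :=
    ⟨Finset.univ.sup fun j => (e j).totalDegree, fun j => Finset.le_sup
      (f := fun j => (e j).totalDegree) (Finset.mem_univ j)⟩
  refine le_pow_of_forall_mul_choose_le _ d c _ fun M => ?_
  -- Monomials of degree at most `M` in the `g i`, times the `e j`, are independent inside the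
  -- polynomials of degree at most `d * M + c`; comparing the two counts gives the binomial
  -- inequality.
  have hdeg : ∀ x : exponentsOfDegreeLE σ M × ι,
      (x.1.1.prod fun i n => g i ^ n) * e x.2 ∈ restrictTotalDegree σ k (d * M + c) := by
    rintro ⟨⟨α, hα⟩, j⟩
    rw [mem_restrictTotalDegree]
    refine (totalDegree_mul _ _).trans (add_le_add ?_ (hc j))
    refine (totalDegree_finsetProd _ _).trans ?_
    calc ∑ i ∈ α.support, (g i ^ α i).totalDegree ≤ ∑ i ∈ α.support, d * α i := by
          refine Finset.sum_le_sum fun i _ => (totalDegree_pow _ _).trans ?_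
          rw [mul_comm]
          exact Nat.mul_le_mul_right _ (hg i)
      _ = d * α.degree := by rw [← Finset.mul_sum, Finsupp.degree_apply]
      _ ≤ d * M := Nat.mul_le_mul_left _ (mem_exponentsOfDegreeLE.mp hα)
  have hli' : LinearIndependent k fun x : exponentsOfDegreeLE σ M × ι =>
      (⟨_, hdeg x⟩ : restrictTotalDegree σ k (d * M + c)) := by
    refine LinearIndependent.of_comp (restrictTotalDegree σ k (d * M + c)).subtype ?_
    refine hli.comp (fun x : exponentsOfDegreeLE σ M × ι => (x.1.1, x.2)) ?_
    rintro ⟨⟨a, _⟩, i⟩ ⟨⟨b, _⟩, j⟩ h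
    simpa using h
  have h1 := hli'.fintype_card_le_finrank
  have h2 : Module.finrank k (restrictTotalDegree σ k (d * M + c)) =
      (exponentsOfDegreeLE σ (d * M + c)).card := by
    rw [restrictTotalDegree, Module.finrank_eq_nat_card_basis (basisRestrictSupport k
      {n : σ →₀ ℕ | (n.sum fun _ e => e) ≤ d * M + c}), Nat.card_coe_set_eq,
      ← Set.ncard_coe_finset]
    congr 1
    ext α
    simp [mem_exponentsOfDegreeLE, Finsupp.degree_apply, Finsupp.sum]
  rw [h2, card_exponentsOfDegreeLE, Fintype.card_prod, Fintype.card_coe,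
    card_exponentsOfDegreeLE, mul_comm] at h1
  exact h1

open MvPolynomial in
/-- A Bézout type bound: if `P` is a minimal prime over a space of polynomials of degree at most
`d` in `n` variables, then the field of constants of the quotient by `P` has degree at most
`d ^ n`. -/
theorem MvPolynomial.card_le_pow_of_mem_minimalPrimes {σ k ι : Type*} [Fintype σ] [Field k]
    [Infinite k] [Fintype ι] (d : ℕ) (hd : 1 ≤ d) (W : Submodule k (MvPolynomial σ k))
    (hW : ∀ f ∈ W, f.totalDegree ≤ d) (P : Ideal (MvPolynomial σ k)) [P.IsPrime]
    (hP : P ∈ (Ideal.span (W : Set (MvPolynomial σ k))).minimalPrimes)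
    (e : ι → MvPolynomial σ k ⧸ P) (he : LinearIndependent k e)
    (halg : ∀ i, IsAlgebraic k (e i)) : Fintype.card ι ≤ d ^ Fintype.card σ := by
  classical
  let Q : ℕ → Prop := fun h => ∃ f : Fin h → MvPolynomial σ k, (∀ i, f i ∈ W) ∧
    P ∈ (Ideal.span (Set.range f)).minimalPrimes
  have hex : ∃ h, Q h := by
    obtain ⟨s, hs, hsW⟩ := (Submodule.fg_span_iff_fg_span_finset_subset _).mp
      ((isNoetherianRing_iff_ideal_fg _).mp inferInstance
        (Ideal.span (W : Set (MvPolynomial σ k))))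
    refine ⟨s.card, fun i => (s.equivFin.symm i : MvPolynomial σ k), fun i => hs (by simp), ?_⟩
    have : Set.range (fun i => (s.equivFin.symm i : MvPolynomial σ k)) = (s : Set _) := by
      ext x
      constructor
      · rintro ⟨i, rfl⟩
        simp
      · intro hx
        exact ⟨s.equivFin ⟨x, hx⟩, by simp⟩
    rw [this]
    rw [Ideal.span, hsW] at hP
    exact hP
  obtain ⟨h, f, hfW, hfP, hmin⟩ : ∃ (h : ℕ) (f : Fin h → MvPolynomial σ k), (∀ i, f i ∈ W) ∧
      P ∈ (Ideal.span (Set.range f)).minimalPrimes ∧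
      ∀ h' < h, ∀ f' : Fin h' → MvPolynomial σ k, (∀ i, f' i ∈ W) →
        P ∉ (Ideal.span (Set.range f')).minimalPrimes := by
    obtain ⟨f, hfW, hfP⟩ := Nat.find_spec hex
    exact ⟨_, f, hfW, hfP, fun h' hh' f' hf' hP' => Nat.find_min hex hh' ⟨f', hf', hP'⟩⟩
  let x : σ → MvPolynomial σ k ⧸ P := fun i => Ideal.Quotient.mk P (X i)
  have hadj : Algebra.adjoin k (Set.range x) = ⊤ := by
    have : Set.range x = Ideal.Quotient.mkₐ k P '' Set.range X := by
      rw [← Set.range_comp]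
      rfl
    rw [this, ← AlgHom.map_adjoin, adjoin_range_X, Algebra.map_top, AlgHom.range_eq_top]
    exact Ideal.Quotient.mkₐ_surjective k P
  have halg' : Algebra.IsAlgebraic (Algebra.adjoin k (Set.range x)) (MvPolynomial σ k ⧸ P) :=
    ⟨fun z => isAlgebraic_algebraMap
      (⟨z, hadj ▸ Algebra.mem_top⟩ : Algebra.adjoin k (Set.range x))⟩
  -- A transcendence basis among the coordinates lifts to variables, whose degree is 1 and so at
  -- most `d`.
  obtain ⟨t, ht, htb⟩ := exists_isTranscendenceBasis_subset (R := k) (Set.range x)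
  have htfin : t.Finite := (Set.finite_range x).subset ht
  have : Fintype t := htfin.fintype
  -- Krull's height theorem bounds the height of `P` by `h`, so the `f i` and the chosen coordinates
  -- are at least as many as the variables.
  have hcard : Fintype.card σ ≤ Fintype.card (Fin h ⊕ t) := by
    have h1 := natCard_le_height_add_trdeg P
    rw [← htb.cardinalMk_eq_trdeg, Cardinal.mk_fintype, map_natCast] at h1
    have h2 : P.height ≤ (h : ℕ∞) := by
      refine (Ideal.height_le_card_of_mem_minimalPrimes_span (Set.finite_range f) hfP).trans ?_
      rw [Nat.cast_le, ← Nat.card_coe_set_eq]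
      exact (Finite.card_range_le f).trans_eq (Nat.card_fin h)
    have h3 := h1.trans (add_le_add_left h2 _)
    rw [Nat.card_eq_fintype_card] at h3
    rw [Fintype.card_sum, Fintype.card_fin]
    exact_mod_cast h3
  choose v hv using ht
  obtain ⟨emb⟩ := Function.Embedding.nonempty_of_card_le hcard
  choose e' he' using fun i => Ideal.Quotient.mk_surjective (e i)
  let y : t → MvPolynomial σ k := fun z => X (v z.2)
  have hb : LinearIndependent k fun p : (t →₀ ℕ) × ι =>
      Ideal.Quotient.mk P ((p.1.prod fun z n => y z ^ n) * e' p.2) := by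
    have := linearIndependent_mul_prod_pow_of_isAlgebraic _ htb.1 e he halg
    have hfun : (fun p : (t →₀ ℕ) × ι =>
        Ideal.Quotient.mk P ((p.1.prod fun z n => y z ^ n) * e' p.2)) =
        fun p => (p.1.prod fun z n => (z : MvPolynomial σ k ⧸ P) ^ n) * e p.2 := by
      funext p
      rw [map_mul, he', Finsupp.prod, Finsupp.prod, map_prod]
      congr 1
      refine Finset.prod_congr rfl fun z _ => ?_
      rw [map_pow]
      congr 1
      exact hv z.2
    rw [hfun]
    exact this
  have hall := linearIndependent_prod_pow_mul W f hfW hfP hmin _ hb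
  let g : σ → MvPolynomial σ k := fun i => Sum.elim f y (emb i)
  refine card_le_pow_of_linearIndependent d g (fun i => ?_) e' ?_
  · rcases hi : emb i with a | z
    · simpa [g, hi] using hW _ (hfW a)
    · simpa [g, hi, y] using hd
  · let r : (σ →₀ ℕ) × ι → (Fin h →₀ ℕ) × ((t →₀ ℕ) × ι) := fun p =>
      ((Finsupp.sumFinsuppEquivProdFinsupp (p.1.embDomain emb)).1,
        (Finsupp.sumFinsuppEquivProdFinsupp (p.1.embDomain emb)).2, p.2)
    have hr : Function.Injective r := by
      rintro ⟨a, i⟩ ⟨b, j⟩ hab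
      simp only [r, Prod.mk.injEq] at hab
      have := Finsupp.sumFinsuppEquivProdFinsupp.injective (Prod.ext hab.1 hab.2.1)
      exact Prod.ext (Finsupp.embDomain_injective emb this) hab.2.2
    have hfun : (fun p : (σ →₀ ℕ) × ι => (p.1.prod fun i n => g i ^ n) * e' p.2) =
        (fun p => (p.1.prod fun i n => f i ^ n) *
          ((p.2.1.prod fun z n => y z ^ n) * e' p.2.2)) ∘ r := by
      funext p
      simp only [r, Function.comp_apply]
      rw [← mul_assoc]
      congr 1
      have h1 : (p.1.prod fun i n => g i ^ n) =
          ((p.1.embDomain emb).prod fun i n => Sum.elim f y i ^ n) := by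
        rw [Finsupp.prod_embDomain]
      rw [h1, Finsupp.prod_fintype _ _ (by simp), Finsupp.prod_fintype _ _ (by simp),
        Finsupp.prod_fintype _ _ (by simp), Fintype.prod_sum_type]
      simp
    rw [hfun]
    exact hall.comp r hr

/-! ### Algebraicity from minimal primes, and the Nullstellensatz -/

open scoped TensorProduct in
/-- If an element `t - c` of `L ⊗ B`, with `c` in the field `L` and `t` in the domain `B`, lies in
a minimal prime, then `c` and `t` are algebraic over the base field. -/
theorem isAlgebraic_of_sub_mem_minimalPrimes {k L B : Type*} [Field k] [Field L] [Algebra k L]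
    [CommRing B] [IsDomain B] [Algebra k B] (q : Ideal (L ⊗[k] B))
    (hq : q ∈ minimalPrimes (L ⊗[k] B))
    (c : L) (t : B) (h : (1 : L) ⊗ₜ[k] t - c ⊗ₜ[k] (1 : B) ∈ q) : IsAlgebraic k t := by
  -- Elements of a minimal prime are zero divisors, so multiplication by `t` and by `c` agree on
  -- some `z ≠ 0`.
  have hnzd := notMem_nonZeroDivisors_of_mem_mem_minimalPrimes h hq
  rw [mem_nonZeroDivisors_iff_right] at hnzd
  push Not at hnzd
  obtain ⟨z, hz, hz0⟩ := hnzd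
  have hcz : (1 : L) ⊗ₜ[k] t * z = c ⊗ₜ[k] (1 : B) * z := by
    rw [mul_comm, ← sub_eq_zero, mul_comm (c ⊗ₜ[k] (1 : B)), ← mul_sub, hz]
  -- the coefficient space of `z`
  let Φ : Module.Dual k B → L ⊗[k] B →ₗ[k] L := fun φ =>
    (TensorProduct.rid k L).toLinearMap ∘ₗ φ.lTensor L
  have hΦ : ∀ φ a b, Φ φ (a ⊗ₜ b) = φ b • a := fun φ a b => by simp [Φ]
  have hΦc : ∀ φ w, Φ φ (c ⊗ₜ[k] (1 : B) * w) = c * Φ φ w := by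
    intro φ w
    induction w with
    | zero => simp
    | add x y hx hy => rw [mul_add, map_add, hx, hy, map_add, mul_add]
    | tmul a b => rw [Algebra.TensorProduct.tmul_mul_tmul, hΦ, hΦ, one_mul, mul_smul_comm]
  have hΦt : ∀ φ w, Φ φ ((1 : L) ⊗ₜ[k] t * w) = Φ (φ ∘ₗ LinearMap.mulLeft k t) w := by
    intro φ w
    induction w with
    | zero => simp
    | add x y hx hy => rw [mul_add, map_add, hx, hy, map_add]
    | tmul a b => rw [Algebra.TensorProduct.tmul_mul_tmul, hΦ, hΦ, one_mul]; rfl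
  let V : Submodule k L := Submodule.span k (Set.range fun φ => Φ φ z)
  have hVfg : V.FG := by
    have : ∀ w : L ⊗[k] B, ∃ N : Submodule k L, N.FG ∧ ∀ φ, Φ φ w ∈ N := by
      intro w
      induction w with
      | zero => exact ⟨⊥, Submodule.fg_bot, fun φ => by simp⟩
      | add x y hx hy =>
        obtain ⟨N, hN, hxN⟩ := hx
        obtain ⟨N', hN', hyN⟩ := hy
        refine ⟨N ⊔ N', hN.sup hN', fun φ => ?_⟩
        rw [map_add]
        exact add_mem (Submodule.mem_sup_left (hxN φ)) (Submodule.mem_sup_right (hyN φ))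
      | tmul a b =>
        refine ⟨k ∙ a, Submodule.fg_span_singleton a, fun φ => ?_⟩
        rw [hΦ]
        exact Submodule.smul_mem _ _ (Submodule.mem_span_singleton_self a)
    obtain ⟨N, hN, hzN⟩ := this z
    have hVN : V ≤ N := by
      rw [Submodule.span_le]
      rintro _ ⟨φ, rfl⟩
      exact hzN φ
    have : FiniteDimensional k N := Module.Finite.iff_fg.mpr hN
    exact Module.Finite.iff_fg.mp (Submodule.finiteDimensional_of_le hVN)
  have hV0 : V ≠ ⊥ := by
    intro hV
    apply hz0
    let b := Module.Basis.ofVectorSpace k B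
    have hb : ∀ i w, (b.baseChange L).repr w i = Φ (b.coord i) w := by
      intro i w
      induction w with
      | zero => simp
      | add x y hx hy => rw [map_add, map_add, Finsupp.add_apply, hx, hy]
      | tmul a x => rw [Module.Basis.baseChange_repr_tmul, hΦ]; rfl
    apply (b.baseChange L).repr.injective
    ext i
    rw [hb, map_zero, Finsupp.zero_apply]
    have : Φ (b.coord i) z ∈ V := Submodule.subset_span ⟨_, rfl⟩
    rwa [hV, Submodule.mem_bot] at this
  -- Multiplication by `c` preserves `V`, since on `z` it can be traded for multiplication by `t`,
  -- which only changes the functional; `V` is nonzero and finite-dimensional.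
  have hc : IsIntegral k c := by
    refine isIntegral_of_smul_mem_submodule V hV0 hVfg c fun n hn => ?_
    induction hn using Submodule.span_induction with
    | mem x hx =>
      obtain ⟨φ, rfl⟩ := hx
      rw [smul_eq_mul]
      change c * Φ φ z ∈ V
      rw [← hΦc, ← hcz, hΦt]
      exact Submodule.subset_span ⟨_, rfl⟩
    | zero => simp
    | add x y _ _ hx hy => rw [smul_add]; exact add_mem hx hy
    | smul a x _ hx => rw [smul_comm]; exact V.smul_mem _ hx
  refine ⟨minpoly k c, minpoly.ne_zero hc, ?_⟩
  have hpoly : ∀ p : Polynomial k, (1 : L) ⊗ₜ[k] (Polynomial.aeval t p) * z =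
      (Polynomial.aeval c p) ⊗ₜ[k] (1 : B) * z := by
    intro p
    have h1 : ∀ p : Polynomial k, Polynomial.aeval ((1 : L) ⊗ₜ[k] t) p =
        (1 : L) ⊗ₜ[k] (Polynomial.aeval t p) := fun p =>
      Polynomial.aeval_algHom_apply (Algebra.TensorProduct.includeRight : B →ₐ[k] L ⊗[k] B) t p
    have h2 : ∀ p : Polynomial k, Polynomial.aeval (c ⊗ₜ[k] (1 : B)) p =
        (Polynomial.aeval c p) ⊗ₜ[k] (1 : B) := fun p =>
      Polynomial.aeval_algHom_apply (Algebra.TensorProduct.includeLeft : L →ₐ[k] L ⊗[k] B) c p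
    rw [← h1, ← h2]
    have hpow : ∀ n : ℕ, ((1 : L) ⊗ₜ[k] t) ^ n * z = (c ⊗ₜ[k] (1 : B)) ^ n * z := by
      intro n
      induction n with
      | zero => simp
      | succ n ih => rw [pow_succ, mul_assoc, hcz, mul_left_comm, ih, pow_succ]; ring
    induction p using Polynomial.induction_on' with
    | add p q hp hq => rw [map_add, map_add, add_mul, add_mul, hp, hq]
    | monomial n a => rw [Polynomial.aeval_monomial, Polynomial.aeval_monomial, mul_assoc, hpow,
        mul_assoc]
  have h0 := hpoly (minpoly k c)
  rw [minpoly.aeval, TensorProduct.zero_tmul, zero_mul] at h0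
  by_contra hne
  apply hz0
  -- `minpoly k c` evaluated at `t` kills `z`. Were it nonzero in the domain `B`, its multiplication
  -- would be injective, also after the flat base change to `L`.
  have hinj : Function.Injective (LinearMap.mulLeft k (Polynomial.aeval t (minpoly k c))) :=
    fun x y hxy => mul_left_cancel₀ hne hxy
  apply Module.Flat.lTensor_preserves_injective_linearMap (M := L) _ hinj
  rw [map_zero, ← h0]
  generalize z = w
  induction w with
  | zero => simp
  | add x y hx hy => rw [map_add, hx, hy, mul_add]
  | tmul a x => simp

/-- Weak Nullstellensatz: a prime ideal in a finitely generated algebra over an algebraically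
closed field is the intersection of the kernels of the points on which it vanishes. -/
theorem exists_algHom_ne_zero_of_notMem {L S : Type*} [Field L] [IsAlgClosed L] [CommRing S]
    [Algebra L S] [Algebra.FiniteType L S] (q : Ideal S) [hq : q.IsPrime] (s : S) (hs : s ∉ q) :
    ∃ ψ : S →ₐ[L] L, (∀ x ∈ q, ψ x = 0) ∧ ψ s ≠ 0 := by
  have hJ : IsJacobsonRing S := isJacobsonRing_of_finiteType (A := L)
  rw [← hJ.out hq.isRadical, Ideal.jacobson, Submodule.mem_sInf] at hs
  push Not at hs
  obtain ⟨m, ⟨hqm, hm⟩, hsm⟩ := hs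
  let _ := Ideal.Quotient.field m
  have : Module.Finite L (S ⧸ m) := finite_of_finite_type_of_isJacobsonRing L (S ⧸ m)
  let E := AlgEquiv.ofBijective (Algebra.ofId L (S ⧸ m))
    (IsAlgClosed.algebraMap_bijective_of_isIntegral (k := L) (K := S ⧸ m))
  refine ⟨E.symm.toAlgHom.comp (Ideal.Quotient.mkₐ L m), fun x hx => ?_, fun h => ?_⟩
  · have : Ideal.Quotient.mk m x = 0 := Ideal.Quotient.eq_zero_iff_mem.mpr (hqm hx)
    simp [this]
  · refine hsm (Ideal.Quotient.eq_zero_iff_mem.mp ?_)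
    have h' : E.symm (Ideal.Quotient.mk m s) = 0 := h
    simpa using h'

/-! ### Irreducible sets of characters -/

namespace PSLCharacterVariety

variable {G : Type*} [Group G]

theorem isClosed_singleton_point (χ : PSLCharacterVariety G) : IsClosed {χ} := by
  rw [isClosed_iff]
  refine ⟨Set.range fun g => MvPolynomial.X g - MvPolynomial.C (χ.1 g), ?_⟩
  ext χ'
  simp only [zeroSet, Set.mem_singleton_iff, Set.forall_mem_range, Set.mem_ofPred_eq, map_sub,
    MvPolynomial.eval_X, MvPolynomial.eval_C, sub_eq_zero]
  exact ⟨fun h => by simp [h], fun h => Subtype.ext (funext h)⟩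

/-- Points are closed, so a second point would make `{χ}` a proper irreducible closed subset of `X`
and force dimension at least one. -/
theorem eq_of_mem_of_topologicalKrullDim_eq_zero {X : Set (PSLCharacterVariety G)}
    (hX : IsIrreducible X) (hdim : topologicalKrullDim X = 0) {χ χ' : PSLCharacterVariety G}
    (h : χ ∈ X) (h' : χ' ∈ X) : χ' = χ := by
  by_contra hne
  have : IrreducibleSpace X := Subtype.irreducibleSpace hX
  have hcl : IsClosed ({⟨χ, h⟩} : Set X) := by
    have : ({⟨χ, h⟩} : Set X) = Subtype.val ⁻¹' {χ} := by
      ext x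
      simp [Subtype.ext_iff]
    rw [this]
    exact (isClosed_singleton_point χ).preimage continuous_subtype_val
  let Z : TopologicalSpace.IrreducibleCloseds X := ⟨{⟨χ, h⟩}, isIrreducible_singleton, hcl⟩
  let T : TopologicalSpace.IrreducibleCloseds X :=
    ⟨Set.univ, IrreducibleSpace.isIrreducible_univ X, isClosed_univ⟩
  have hlt : Z < T := by
    refine lt_of_le_of_ne (fun _ _ => trivial) fun hZT => ?_
    have : (⟨χ', h'⟩ : X) ∈ (Z : Set X) := by rw [hZT]; trivial
    exact hne (congrArg Subtype.val (Set.mem_singleton_iff.mp this))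
  have := Order.one_le_krullDim_iff.mpr ⟨Z, T, hlt⟩
  rw [topologicalKrullDim] at hdim
  rw [hdim] at this
  exact absurd this (by simp)

/-- A family of characters parametrised by the points of an irreducible affine variety is
irreducible. -/
theorem isPreirreducible_range_of_algHom {S : Type*} [CommRing S] [Algebra ℂ S]
    [Algebra.FiniteType ℂ S] (q : Ideal S) [q.IsPrime] (f : G → S)
    (hf : ∀ ψ : S →ₐ[ℂ] ℂ, (∀ x ∈ q, ψ x = 0) →
      ∃ χ : PSLCharacterVariety G, ∀ g, χ.1 g = ψ (f g)) :
    IsPreirreducible {χ : PSLCharacterVariety G |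
      ∃ ψ : S →ₐ[ℂ] ℂ, (∀ x ∈ q, ψ x = 0) ∧ ∀ g, χ.1 g = ψ (f g)} := by
  set Y := {χ : PSLCharacterVariety G |
    ∃ ψ : S →ₐ[ℂ] ℂ, (∀ x ∈ q, ψ x = 0) ∧ ∀ g, χ.1 g = ψ (f g)} with hYdef
  have heval : ∀ (χ : PSLCharacterVariety G) (ψ : S →ₐ[ℂ] ℂ), (∀ g, χ.1 g = ψ (f g)) →
      ∀ p : MvPolynomial G ℂ, MvPolynomial.eval χ.1 p = ψ (MvPolynomial.aeval f p) := by
    intro χ ψ h p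
    rw [MvPolynomial.comp_aeval_apply, ← funext h, MvPolynomial.aeval_eq_eval]
  -- A nonempty open piece of `Y` contains the nonvanishing locus of some `p` outside `q`. For two
  -- pieces the product is still outside the prime `q`, and the Nullstellensatz finds a common
  -- point.
  have key : ∀ U : Set (PSLCharacterVariety G), IsOpen U → (Y ∩ U).Nonempty →
      ∃ p : MvPolynomial G ℂ, MvPolynomial.aeval f p ∉ q ∧
        ∀ χ : PSLCharacterVariety G, MvPolynomial.eval χ.1 p ≠ 0 → χ ∈ U := by
    rintro U hU ⟨χ, hχY, hχU⟩
    obtain ⟨Z, hZ⟩ := (isClosed_iff _).mp hU.isClosed_compl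
    have hχZ : χ ∉ zeroSet Z := by rw [← hZ]; simpa using hχU
    simp only [zeroSet, Set.mem_ofPred_eq, not_forall] at hχZ
    obtain ⟨p, hpZ, hp⟩ := hχZ
    refine ⟨p, fun hpq => hp ?_, fun χ' hχ' => ?_⟩
    · obtain ⟨ψ, hψ, hχψ⟩ := hχY
      rw [heval χ ψ hχψ, hψ _ hpq]
    · by_contra hcon
      have : χ' ∈ zeroSet Z := by rw [← hZ]; exact hcon
      exact hχ' (this p hpZ)
  intro U V hU hV hYU hYV
  obtain ⟨p, hp, hpU⟩ := key U hU hYU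
  obtain ⟨r, hr, hrV⟩ := key V hV hYV
  obtain ⟨ψ, hψ, hψne⟩ := exists_algHom_ne_zero_of_notMem (L := ℂ) q (MvPolynomial.aeval f (p * r))
    (by rw [map_mul]; exact fun h => (Ideal.IsPrime.mem_or_mem ‹_› h).elim hp hr)
  obtain ⟨χ, hχ⟩ := hf ψ hψ
  rw [← heval χ ψ hχ, map_mul, mul_ne_zero_iff] at hψne
  exact ⟨χ, ⟨ψ, hψ, hχ⟩, hpU χ hψne.1, hrV χ hψne.2⟩

end PSLCharacterVariety

/-! ### Lifts to `SL(2, ℂ)` and algebraicity of traces -/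

theorem toPSL_eq_one_iff (A : SL(2, ℂ)) : toPSL A = 1 ↔ A.val = 1 ∨ A.val = -1 := by
  rw [toPSL, QuotientGroup.mk'_apply, QuotientGroup.eq_one_iff,
    Matrix.SpecialLinearGroup.mem_center_iff]
  constructor
  · rintro ⟨r, hr, hA⟩
    rw [Fintype.card_fin, sq_eq_one_iff] at hr
    rcases hr with rfl | rfl
    · exact Or.inl (by rw [← hA, map_one])
    · exact Or.inr (by rw [← hA, map_neg, map_one])
  · rintro (h | h)
    · exact ⟨1, by simp, by rw [h, map_one]⟩
    · exact ⟨-1, by simp, by rw [h, map_neg, map_one]⟩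

theorem toPSL_eq_toPSL_iff (A B : SL(2, ℂ)) :
    toPSL A = toPSL B ↔ A.val = B.val ∨ A.val = -B.val := by
  have h1 : toPSL A = toPSL B ↔ toPSL (A * B⁻¹) = 1 := by
    rw [map_mul, map_inv, mul_inv_eq_one]
  have h2 : A.val = (A * B⁻¹).val * B.val := by
    rw [← Matrix.SpecialLinearGroup.coe_mul, inv_mul_cancel_right]
  have h3 : (A * B⁻¹).val = A.val * B⁻¹.val := rfl
  have h4 : B.val * B⁻¹.val = 1 := by
    rw [← Matrix.SpecialLinearGroup.coe_mul, mul_inv_cancel]; rfl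
  rw [h1, toPSL_eq_one_iff]
  constructor
  · rintro (h | h)
    · exact Or.inl (by rw [h2, h, one_mul])
    · exact Or.inr (by rw [h2, h, neg_one_mul])
  · rintro (h | h)
    · exact Or.inl (by rw [h3, h, h4])
    · exact Or.inr (by rw [h3, h, Matrix.neg_mul, h4])

theorem toPSL_surjective : Function.Surjective toPSL := QuotientGroup.mk'_surjective _

theorem sqTrace_toPSL (A : SL(2, ℂ)) : sqTrace (toPSL A) = A.val.trace ^ 2 := rfl

theorem trace_specialLinearGroup_map {R S : Type*} [CommRing R] [CommRing S] (f : R →+* S)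
    (A : SL(2, R)) : (Matrix.SpecialLinearGroup.map f A).val.trace = f A.val.trace := by
  simp [Matrix.trace_fin_two]

-- Complex points of `ℂ ⊗ B` are representations of `G`. Those on a component through `ψ₀` have an
-- irreducible set of characters, which by maximality of `X` is the single point `χ_ρ`. Hence the
-- squared trace of `w` is constant modulo the minimal prime `q`.
open scoped TensorProduct in
theorem isAlgebraic_trace_of_isolated {G : Type*} [Group G] {n : ℕ}
    {rels : Set (FreeGroup (Fin n))} (π : FreeGroup (Fin n) →* G) (hπ : Function.Surjective π)
    (hker : ∀ φ : FreeGroup (Fin n) →* PSL(2, ℂ), (∀ r ∈ rels, φ r = 1) →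
      ∃ ρ : G →* PSL(2, ℂ), ρ.comp π = φ)
    {B : Type*} [CommRing B] [IsDomain B] [Algebra ℚ B] [Algebra.FiniteType ℚ B]
    (a : Fin n → SL(2, B))
    (hrel : ∀ r ∈ rels, (FreeGroup.lift a r).val = 1 ∨ (FreeGroup.lift a r).val = -1)
    (ψ₀ : B →ₐ[ℚ] ℂ) {X : Set (PSLCharacterVariety G)}
    (hX : X ∈ irreducibleComponents (PSLCharacterVariety G)) (hdim : topologicalKrullDim X = 0)
    {ρ : G →* PSL(2, ℂ)} (hρ : PSLCharacterVariety.ofRep ρ ∈ X)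
    (hρa : ρ.comp π = toPSL.comp
      ((Matrix.SpecialLinearGroup.map (ψ₀ : B →+* ℂ)).comp (FreeGroup.lift a)))
    (w : FreeGroup (Fin n)) : IsAlgebraic ℚ (FreeGroup.lift a w).val.trace := by
  let S := ℂ ⊗[ℚ] B
  let incl : B →ₐ[ℚ] S := Algebra.TensorProduct.includeRight
  let Ψ₀ : S →ₐ[ℂ] ℂ := Algebra.TensorProduct.lift (Algebra.ofId ℂ ℂ) ψ₀ fun _ _ => Commute.all _ _
  have hΨ₀ : ∀ b, Ψ₀ (incl b) = ψ₀ b := fun b => by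
    change Ψ₀ ((1 : ℂ) ⊗ₜ[ℚ] b) = ψ₀ b
    rw [Algebra.TensorProduct.lift_tmul, map_one, one_mul]
  have hkerprime : (RingHom.ker Ψ₀).IsPrime := RingHom.ker_isPrime _
  obtain ⟨q, hq, hqle⟩ := Ideal.exists_minimalPrimes_le (bot_le : (⊥ : Ideal S) ≤ RingHom.ker Ψ₀)
  have hqp : q.IsPrime := hq.1.1
  choose word hword using hπ
  let tr : FreeGroup (Fin n) → B := fun w => (FreeGroup.lift a w).val.trace
  -- every point of the algebra gives a representation
  have hpt : ∀ ψ : S →ₐ[ℂ] ℂ, ∃ ρ' : G →* PSL(2, ℂ), ∀ w, pslCharacter ρ' (π w) =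
      ψ (incl (tr w) ^ 2) := by
    intro ψ
    let ψ' : B →+* ℂ := (ψ : S →+* ℂ).comp (incl : B →+* S)
    obtain ⟨ρ', hρ'⟩ := hker
      (toPSL.comp ((Matrix.SpecialLinearGroup.map ψ').comp (FreeGroup.lift a))) (by
        intro r hr
        rw [MonoidHom.comp_apply, toPSL_eq_one_iff]
        refine (hrel r hr).imp (fun h => ?_) (fun h => ?_)
        · rw [MonoidHom.comp_apply, Matrix.SpecialLinearGroup.map_apply_coe, h, map_one]
        · rw [MonoidHom.comp_apply, Matrix.SpecialLinearGroup.map_apply_coe, h, map_neg, map_one])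
    refine ⟨ρ', fun w => ?_⟩
    have : ρ' (π w) = _ := DFunLike.congr_fun hρ' w
    rw [pslCharacter, this, MonoidHom.comp_apply, sqTrace_toPSL, MonoidHom.comp_apply,
      trace_specialLinearGroup_map, map_pow]
    rfl
  have hpre := PSLCharacterVariety.isPreirreducible_range_of_algHom q
    (fun g => incl (tr (word g)) ^ 2) (fun ψ _ => by
      obtain ⟨ρ', hρ'⟩ := hpt ψ
      refine ⟨PSLCharacterVariety.ofRep ρ', fun g => ?_⟩
      have := hρ' (word g)
      rw [hword] at this
      exact this)
  set Y := {χ : PSLCharacterVariety G | ∃ ψ : S →ₐ[ℂ] ℂ, (∀ x ∈ q, ψ x = 0) ∧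
    ∀ g, χ.1 g = ψ (incl (tr (word g)) ^ 2)} with hY
  have hχ₀ : ∀ w, pslCharacter ρ (π w) = ψ₀ (tr w) ^ 2 := by
    intro w
    have : ρ (π w) = _ := DFunLike.congr_fun hρa w
    rw [pslCharacter, this, MonoidHom.comp_apply, sqTrace_toPSL, MonoidHom.comp_apply,
      trace_specialLinearGroup_map]
    rfl
  have hρY : PSLCharacterVariety.ofRep ρ ∈ Y := by
    refine ⟨Ψ₀, fun x hx => hqle hx, fun g => ?_⟩
    have := hχ₀ (word g)
    rw [hword] at this
    rw [map_pow, hΨ₀]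
    exact this
  have hXeq : ∀ χ ∈ X, χ = PSLCharacterVariety.ofRep ρ := fun χ hχ =>
    PSLCharacterVariety.eq_of_mem_of_topologicalKrullDim_eq_zero hX.1 hdim hρ hχ
  have hYirr : IsIrreducible (closure Y) := IsIrreducible.closure ⟨⟨_, hρY⟩, hpre⟩
  have hXY : X ⊆ closure Y := fun χ hχ => by
    rw [hXeq χ hχ]
    exact subset_closure hρY
  have hYX : Y ⊆ X := subset_closure.trans (hX.2 hYirr hXY)
  have hsq : incl (tr w) ^ 2 - algebraMap ℂ S (ψ₀ (tr w)) ^ 2 ∈ q := by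
    by_contra hcon
    obtain ⟨ψ, hψ, hne⟩ := exists_algHom_ne_zero_of_notMem (L := ℂ) q _ hcon
    apply hne
    obtain ⟨ρ', hρ'⟩ := hpt ψ
    have hmem : PSLCharacterVariety.ofRep ρ' ∈ Y := ⟨ψ, hψ, fun g => by
      have := hρ' (word g)
      rw [hword] at this
      exact this⟩
    have heq := congrArg Subtype.val (hXeq _ (hYX hmem))
    have h1 : pslCharacter ρ' (π w) = pslCharacter ρ (π w) := congrFun heq (π w)
    rw [hρ', hχ₀] at h1
    rw [map_sub, h1, map_pow, AlgHom.commutes]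
    simp
  -- Only squares of traces are known to be constant; factoring puts `t - c` or `t + c` in the prime
  -- `q`.
  have hfac : incl (tr w) ^ 2 - algebraMap ℂ S (ψ₀ (tr w)) ^ 2 =
      ((1 : ℂ) ⊗ₜ[ℚ] tr w - ψ₀ (tr w) ⊗ₜ[ℚ] (1 : B)) *
        ((1 : ℂ) ⊗ₜ[ℚ] tr w - (-ψ₀ (tr w)) ⊗ₜ[ℚ] (1 : B)) := by
    have h1 : algebraMap ℂ S (ψ₀ (tr w)) = ψ₀ (tr w) ⊗ₜ[ℚ] (1 : B) := rfl
    have h2 : incl (tr w) = (1 : ℂ) ⊗ₜ[ℚ] tr w := rfl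
    rw [h1, h2, TensorProduct.neg_tmul]
    ring
  rw [hfac] at hsq
  rcases hqp.mem_or_mem hsq with h | h
  · exact isAlgebraic_of_sub_mem_minimalPrimes q hq _ _ h
  · exact isAlgebraic_of_sub_mem_minimalPrimes q hq _ _ h

/-! ### Quadratic equations for representations -/

/-- The product of matrices along a word, with the inverse of a letter replaced by the adjugate. -/
def wordMatrix {R : Type*} [CommRing R] {n : ℕ} (M : Fin n → Matrix (Fin 2) (Fin 2) R)
    (L : List (Fin n × Bool)) : Matrix (Fin 2) (Fin 2) R :=
  (L.map fun x => bif x.2 then M x.1 else (M x.1).adjugate).prod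

theorem wordMatrix_map {R S : Type*} [CommRing R] [CommRing S] (f : R →+* S) {n : ℕ}
    (M : Fin n → Matrix (Fin 2) (Fin 2) R) (L : List (Fin n × Bool)) :
    wordMatrix (fun i => (M i).map f) L = (wordMatrix M L).map f := by
  change _ = f.mapMatrix (wordMatrix M L)
  rw [wordMatrix, wordMatrix, map_list_prod, List.map_map]
  congr 2
  funext x
  rcases x with ⟨i, _ | _⟩
  · exact (RingHom.map_adjugate f (M i)).symm
  · rfl

theorem wordMatrix_eq_lift {R : Type*} [CommRing R] {n : ℕ} (a : Fin n → SL(2, R))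
    (L : List (Fin n × Bool)) :
    wordMatrix (fun i => (a i).val) L = (FreeGroup.lift a (FreeGroup.mk L)).val := by
  rw [FreeGroup.lift_mk, wordMatrix]
  induction L with
  | nil => rfl
  | cons x L ih =>
    rw [List.map_cons, List.prod_cons, ih, List.map_cons, List.prod_cons,
      Matrix.SpecialLinearGroup.coe_mul]
    rcases x with ⟨i, _ | _⟩
    · exact congrArg (· * _) (Matrix.SpecialLinearGroup.coe_inv (a i)).symm
    · rfl

/-- The matrix of generic entries. -/
def genericMatrix (n : ℕ) (i : Fin n) :
    Matrix (Fin 2) (Fin 2) (MvPolynomial (Fin n × Fin 2 × Fin 2) ℚ) :=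
  Matrix.of fun a b => MvPolynomial.X (i, a, b)

/-- The adjugate of a 2 × 2 matrix is linear in its entries, so an inverse letter costs one degree,
like a letter. -/
theorem totalDegree_wordMatrix_le {n : ℕ} (L : List (Fin n × Bool)) (hL : L.length ≤ 2)
    (a b : Fin 2) : (wordMatrix (genericMatrix n) L a b).totalDegree ≤ 2 := by
  have h1 : ∀ (x : Fin n × Bool) (a b : Fin 2),
      ((bif x.2 then genericMatrix n x.1 else (genericMatrix n x.1).adjugate) a b).totalDegree
        ≤ 1 := by
    rintro ⟨i, _ | _⟩ a b <;> fin_cases a <;> fin_cases b <;>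
      simp [genericMatrix, Matrix.adjugate_fin_two]
  match L, hL with
  | [], _ => fin_cases a <;> fin_cases b <;> simp [wordMatrix]
  | [x], _ => simpa [wordMatrix] using (h1 x a b).trans one_le_two
  | [x, y], _ =>
    simp only [wordMatrix, List.map_cons, List.map_nil, List.prod_cons, List.prod_nil, mul_one,
      Matrix.mul_apply]
    refine MvPolynomial.totalDegree_finsetSum_le fun i _ => ?_
    exact (MvPolynomial.totalDegree_mul _ _).trans (add_le_add (h1 x a i) (h1 y i b))

/-- The equations for a representation into `SL₂` in which each relator `r` is sent to `ε r`:
the determinants, and the relators in a form of degree two. -/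
def repEquations {n : ℕ} (rels : Set (FreeGroup (Fin n))) (ε : FreeGroup (Fin n) → ℚ) :
    Set (MvPolynomial (Fin n × Fin 2 × Fin 2) ℚ) :=
  (Set.range fun i => (genericMatrix n i).det - 1) ∪
    {f | ∃ r ∈ rels, ∃ a b, f = (wordMatrix (genericMatrix n) (r.toWord.take 2) -
      ε r • wordMatrix (genericMatrix n) (FreeGroup.invRev (r.toWord.drop 2))) a b}

theorem totalDegree_le_of_mem_repEquations {n : ℕ} {rels : Set (FreeGroup (Fin n))}
    (hrels : ∀ r ∈ rels, r.norm ≤ 3) {ε : FreeGroup (Fin n) → ℚ}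
    {f : MvPolynomial (Fin n × Fin 2 × Fin 2) ℚ} (hf : f ∈ repEquations rels ε) :
    f.totalDegree ≤ 2 := by
  rcases hf with ⟨i, rfl⟩ | ⟨r, hr, a, b, rfl⟩
  · simp only [Matrix.det_fin_two, genericMatrix, Matrix.of_apply]
    refine (MvPolynomial.totalDegree_sub _ _).trans (max_le ?_ (by simp))
    refine (MvPolynomial.totalDegree_sub _ _).trans (max_le ?_ ?_) <;>
      exact (MvPolynomial.totalDegree_mul _ _).trans (by simp)
  · rw [Matrix.sub_apply, Matrix.smul_apply]
    have h3 : r.toWord.length ≤ 3 := hrels r hr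
    refine (MvPolynomial.totalDegree_sub _ _).trans (max_le ?_ ?_)
    · exact totalDegree_wordMatrix_le _ (by simp) _ _
    · refine (MvPolynomial.totalDegree_smul_le _ _).trans (totalDegree_wordMatrix_le _ ?_ _ _)
      rw [FreeGroup.invRev_length, List.length_drop]
      omega

/-- The entries of the equation of degree two for a relator vanish exactly if the relator is
satisfied up to the given sign. -/
theorem forall_relator_eq_zero_iff {n : ℕ}
    (ε : FreeGroup (Fin n) → ℚ) {R : Type*} [CommRing R] [Algebra ℚ R]
    (f : MvPolynomial (Fin n × Fin 2 × Fin 2) ℚ →ₐ[ℚ] R) (a : Fin n → SL(2, R))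
    (ha : ∀ i, (a i).val = (genericMatrix n i).map f) (r : FreeGroup (Fin n)) :
    (∀ i j, f ((wordMatrix (genericMatrix n) (r.toWord.take 2) -
      ε r • wordMatrix (genericMatrix n) (FreeGroup.invRev (r.toWord.drop 2))) i j) = 0) ↔
      (FreeGroup.lift a r).val = ε r • (1 : Matrix (Fin 2) (Fin 2) R) := by
  have hw : ∀ L, (wordMatrix (genericMatrix n) L).map f =
      (FreeGroup.lift a (FreeGroup.mk L)).val := by
    intro L
    rw [← wordMatrix_eq_lift, funext ha]
    exact (wordMatrix_map f.toRingHom _ L).symm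
  set u := FreeGroup.lift a (FreeGroup.mk (r.toWord.take 2)) with hu
  set v := FreeGroup.lift a (FreeGroup.mk (r.toWord.drop 2)) with hv
  have huv : FreeGroup.lift a r = u * v := by
    rw [hu, hv, ← map_mul, FreeGroup.mul_mk, List.take_append_drop, FreeGroup.mk_toWord]
  have hinv : (wordMatrix (genericMatrix n) (FreeGroup.invRev (r.toWord.drop 2))).map f =
      (v⁻¹).val := by
    rw [hw, hv, ← map_inv, FreeGroup.inv_mk]
  have hvv : (v⁻¹).val * v.val = 1 := by
    rw [← Matrix.SpecialLinearGroup.coe_mul, inv_mul_cancel]; rfl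
  have hvv' : v.val * (v⁻¹).val = 1 := by
    rw [← Matrix.SpecialLinearGroup.coe_mul, mul_inv_cancel]; rfl
  have h1 : (∀ i j, f ((wordMatrix (genericMatrix n) (r.toWord.take 2) -
      ε r • wordMatrix (genericMatrix n) (FreeGroup.invRev (r.toWord.drop 2))) i j) = 0) ↔
      u.val = ε r • (v⁻¹).val := by
    rw [← hw, ← hinv, ← Matrix.ext_iff]
    refine forall_congr' fun i => forall_congr' fun j => ?_
    rw [Matrix.sub_apply, Matrix.smul_apply, map_sub, map_smul, sub_eq_zero, Matrix.smul_apply,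
      Matrix.map_apply, Matrix.map_apply]
  rw [h1, huv, Matrix.SpecialLinearGroup.coe_mul]
  constructor
  · intro h
    rw [h, smul_mul_assoc, hvv]
  · intro h
    rw [← mul_one u.val, ← hvv', ← mul_assoc, h, smul_mul_assoc, one_mul]

/-! ### Degree bound for the trace field -/

/-- The trace field of an isolated representation of a group with `n` generators and relators of
length at most three has degree at most `2 ^ (4 * n)`. -/
theorem rank_traceField_le_of_isolated {G : Type*} [Group G] {n : ℕ}
    {rels : Set (FreeGroup (Fin n))} (hlen : ∀ r ∈ rels, r.norm ≤ 3)
    (π : FreeGroup (Fin n) →* G) (hπ : Function.Surjective π) (hπr : ∀ r ∈ rels, π r = 1)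
    (hker : ∀ φ : FreeGroup (Fin n) →* PSL(2, ℂ), (∀ r ∈ rels, φ r = 1) →
      ∃ ρ : G →* PSL(2, ℂ), ρ.comp π = φ)
    {X : Set (PSLCharacterVariety G)}
    (hX : X ∈ irreducibleComponents (PSLCharacterVariety G)) (hdim : topologicalKrullDim X = 0)
    {ρ : G →* PSL(2, ℂ)} (hρ : PSLCharacterVariety.ofRep ρ ∈ X) :
    Module.rank ℚ (traceField ρ.range) ≤ (2 ^ (4 * n) : ℕ) := by
  classical
  choose α hα using fun i => toPSL_surjective (ρ (π (FreeGroup.of i)))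
  have hlift : ρ.comp π = toPSL.comp (FreeGroup.lift α) :=
    FreeGroup.ext_hom _ _ fun i => by simp [hα]
  have hlift' : ∀ w, ρ (π w) = toPSL (FreeGroup.lift α w) := fun w => DFunLike.congr_fun hlift w
  have hsign : ∀ r, ∃ ε : ℚ, r ∈ rels → ((ε = 1 ∨ ε = -1) ∧
      (FreeGroup.lift α r).val = ε • (1 : Matrix (Fin 2) (Fin 2) ℂ)) := by
    intro r
    by_cases hr : r ∈ rels
    · have : toPSL (FreeGroup.lift α r) = 1 := by rw [← hlift', hπr r hr, map_one]
      rcases (toPSL_eq_one_iff _).mp this with h | h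
      · exact ⟨1, fun _ => ⟨Or.inl rfl, by rw [h, one_smul]⟩⟩
      · exact ⟨-1, fun _ => ⟨Or.inr rfl, by rw [h, neg_one_smul]⟩⟩
    · exact ⟨0, fun h => absurd h hr⟩
  choose ε hε using hsign
  let A := MvPolynomial (Fin n × Fin 2 × Fin 2) ℚ
  let ev : A →ₐ[ℚ] ℂ := MvPolynomial.aeval fun x => (α x.1).val x.2.1 x.2.2
  have hev : ∀ i, (α i).val = (genericMatrix n i).map ev := by
    intro i
    ext a b
    exact (MvPolynomial.aeval_X (fun x : Fin n × Fin 2 × Fin 2 => (α x.1).val x.2.1 x.2.2)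
      (i, a, b)).symm
  let W : Submodule ℚ A := Submodule.span ℚ (repEquations rels ε)
  have hWdeg : ∀ f ∈ W, f.totalDegree ≤ 2 := by
    have : W ≤ MvPolynomial.restrictTotalDegree _ ℚ 2 := by
      rw [Submodule.span_le]
      intro f hf
      exact (MvPolynomial.mem_restrictTotalDegree _ _ _).mpr
        (totalDegree_le_of_mem_repEquations hlen hf)
    exact fun f hf => (MvPolynomial.mem_restrictTotalDegree _ _ _).mp (this hf)
  have hWker : Ideal.span (W : Set A) ≤ RingHom.ker ev := by
    rw [Ideal.span_le]
    intro f hf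
    induction hf using Submodule.span_induction with
    | mem f hf =>
      rcases hf with ⟨i, rfl⟩ | ⟨r, hr, a, b, rfl⟩
      · change ev ((genericMatrix n i).det - 1) = 0
        have : ev (genericMatrix n i).det = (α i).val.det := by
          rw [hev, AlgHom.map_det]
          rfl
        rw [map_sub, this, map_one, (α i).2, sub_self]
      · exact (forall_relator_eq_zero_iff ε ev α hev r).mpr (hε r hr).2 a b
    | zero => exact zero_mem (RingHom.ker ev)
    | add x y _ _ hx hy => exact add_mem (S := Ideal A) hx hy
    | smul c x _ hx =>
      change ev (c • x) = 0
      rw [map_smul, show ev x = 0 from hx, smul_zero]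
  have hkerprime : (RingHom.ker ev).IsPrime := RingHom.ker_isPrime _
  obtain ⟨P, hP, hPle⟩ := Ideal.exists_minimalPrimes_le hWker
  have hPp : P.IsPrime := hP.1.1
  let B := A ⧸ P
  let mk : A →ₐ[ℚ] B := Ideal.Quotient.mkₐ ℚ P
  have hmk : ∀ f ∈ repEquations rels ε, mk f = 0 := fun f hf =>
    Ideal.Quotient.eq_zero_iff_mem.mpr (hP.1.2 (Ideal.subset_span (Submodule.subset_span hf)))
  let a : Fin n → SL(2, B) := fun i => ⟨(genericMatrix n i).map mk, by
    have h1 := hmk _ (Or.inl ⟨i, rfl⟩)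
    rw [map_sub, map_one, sub_eq_zero, AlgHom.map_det] at h1
    exact h1⟩
  have hrel : ∀ r ∈ rels, (FreeGroup.lift a r).val = ε r • (1 : Matrix (Fin 2) (Fin 2) B) :=
    fun r hr => (forall_relator_eq_zero_iff ε mk a (fun i => rfl) r).mp fun i j =>
      hmk _ (Or.inr ⟨r, hr, i, j, rfl⟩)
  let ψ₀ : B →ₐ[ℚ] ℂ := Ideal.Quotient.liftₐ P ev fun x hx => hPle hx
  have hψa : (Matrix.SpecialLinearGroup.map (ψ₀ : B →+* ℂ)).comp (FreeGroup.lift a) =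
      FreeGroup.lift α := by
    refine FreeGroup.ext_hom _ _ fun i => ?_
    rw [MonoidHom.comp_apply, FreeGroup.lift_apply_of, FreeGroup.lift_apply_of]
    apply Subtype.ext
    rw [hev]
    rfl
  let tr : FreeGroup (Fin n) → B := fun w => (FreeGroup.lift a w).val.trace
  have hψtr : ∀ w, ψ₀ (tr w) = (FreeGroup.lift α w).val.trace := by
    intro w
    rw [← hψa, MonoidHom.comp_apply, trace_specialLinearGroup_map]
    rfl
  have halg : ∀ w, IsAlgebraic ℚ (tr w) := by
    refine isAlgebraic_trace_of_isolated π hπ hker a (fun r hr => ?_) ψ₀ hX hdim hρ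
      (by rw [hψa, hlift])
    rcases (hε r hr).1 with h | h
    · exact Or.inl (by rw [hrel r hr, h, one_smul])
    · exact Or.inr (by rw [hrel r hr, h, neg_one_smul])
  let T : Subalgebra ℚ B := Algebra.adjoin ℚ (Set.range tr)
  have hT : T ≤ integralClosure ℚ B := by
    refine Algebra.adjoin_le ?_
    rintro _ ⟨w, rfl⟩
    exact (halg w).isIntegral
  have htraces : ∀ x ∈ {x | ∃ C : SL(2, ℂ), toPSL C ∈ ρ.range ∧ x = C.val.trace},
      ∃ b ∈ T, ψ₀ b = x := by
    rintro _ ⟨C, ⟨g, hg⟩, rfl⟩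
    obtain ⟨w, rfl⟩ := hπ g
    rw [hlift'] at hg
    have hw : tr w ∈ T := Algebra.subset_adjoin ⟨w, rfl⟩
    rcases (toPSL_eq_toPSL_iff _ _).mp hg.symm with h | h
    · exact ⟨tr w, hw, by rw [hψtr, h]⟩
    · exact ⟨-tr w, neg_mem hw, by rw [map_neg, hψtr, h, Matrix.trace_neg]⟩
  -- The traces are algebraic, so the field they generate is already the algebra they generate,
  -- hence lies in the image of `T`.
  have hfield : ∀ v ∈ traceField ρ.range, ∃ b ∈ T, ψ₀ b = v := by
    intro v hv
    rw [← IntermediateField.mem_toSubalgebra, traceField,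
      IntermediateField.adjoin_toSubalgebra_of_isAlgebraic (fun x hx => by
        obtain ⟨b, hb, rfl⟩ := htraces x hx
        exact ((hT hb).map ψ₀).isAlgebraic)] at hv
    have hle : Algebra.adjoin ℚ {x | ∃ C : SL(2, ℂ), toPSL C ∈ ρ.range ∧ x = C.val.trace} ≤
        T.map ψ₀ := Algebra.adjoin_le fun x hx => htraces x hx
    exact hle hv
  refine rank_le fun s hs => ?_
  choose b hbT hbv using fun v : s => hfield v.1.1 v.1.2
  have hli : LinearIndependent ℚ b := by
    refine LinearIndependent.of_comp ψ₀.toLinearMap ?_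
    have h1 := hs.map' (traceField ρ.range).val.toLinearMap
      (LinearMap.ker_eq_bot.mpr (traceField ρ.range).val.injective)
    have h2 : (ψ₀.toLinearMap ∘ b) = (traceField ρ.range).val.toLinearMap ∘ fun i : s => i.1 :=
      funext hbv
    rw [h2]
    exact h1
  have := MvPolynomial.card_le_pow_of_mem_minimalPrimes 2 one_le_two W hWdeg P hP b hli
    (fun v => IsIntegral.isAlgebraic (hT (hbT v)))
  rw [Fintype.card_coe] at this
  refine this.trans (le_of_eq ?_)
  congr 1
  simp only [Fintype.card_prod, Fintype.card_fin]
  omega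

/-! ### Elementary representations and conclusion -/

theorem exists_fixedPoint (A : SL(2, ℂ)) :
    ∃ z : OnePoint ℂ, (A : GL (Fin 2) ℂ) • z = z := by
  by_cases h : (A : GL (Fin 2) ℂ) 1 0 = 0
  · exact ⟨OnePoint.infty, OnePoint.smul_infty_eq_self_iff.mpr h⟩
  · have hdeg : (A : GL (Fin 2) ℂ).fixpointPolynomial.degree = 2 := by
      rw [← Polynomial.degree_quadratic (b := (A : GL (Fin 2) ℂ) 1 1 - (A : GL (Fin 2) ℂ) 0 0)
        (c := -(A : GL (Fin 2) ℂ) 0 1) h, Matrix.GeneralLinearGroup.fixpointPolynomial]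
      congr 1
      rw [map_neg, sub_eq_add_neg]
    obtain ⟨c, hc⟩ := IsAlgClosed.exists_root (A : GL (Fin 2) ℂ).fixpointPolynomial
      (by rw [hdeg]; decide)
    refine ⟨(c : OnePoint ℂ), Matrix.GeneralLinearGroup.fixpointPolynomial_aeval_eq_zero_iff.mp ?_⟩
    rwa [Polynomial.coe_aeval_eq_eval]

theorem smul_eq_of_eq_neg {A B : SL(2, ℂ)} (h : A.val = -B.val) (z : OnePoint ℂ) :
    (A : GL (Fin 2) ℂ) • z = (B : GL (Fin 2) ℂ) • z := by
  have h' : ∀ i j, (A : GL (Fin 2) ℂ) i j = -(B : GL (Fin 2) ℂ) i j := fun i j =>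
    congrFun (congrFun h i) j
  cases z with
  | infty =>
    rw [OnePoint.smul_infty_eq_ite, OnePoint.smul_infty_eq_ite]
    simp only [h', neg_eq_zero, neg_div_neg_eq]
  | coe c =>
    rw [OnePoint.smul_some_eq_ite, OnePoint.smul_some_eq_ite]
    have h1 : (A : GL (Fin 2) ℂ) 1 0 * c + (A : GL (Fin 2) ℂ) 1 1 =
        -((B : GL (Fin 2) ℂ) 1 0 * c + (B : GL (Fin 2) ℂ) 1 1) := by rw [h', h']; ring
    have h2 : (A : GL (Fin 2) ℂ) 0 0 * c + (A : GL (Fin 2) ℂ) 0 1 =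
        -((B : GL (Fin 2) ℂ) 0 0 * c + (B : GL (Fin 2) ℂ) 0 1) := by rw [h', h']; ring
    simp only [h1, h2, neg_eq_zero, neg_div_neg_eq]

/-- A representation of a group with at most one generator is elementary. -/
theorem isElementary_range_of_subsingleton {G : Type*} [Group G] {n : ℕ} (hn : n ≤ 1)
    (π : FreeGroup (Fin n) →* G) (hπ : Function.Surjective π) (ρ : G →* PSL(2, ℂ)) :
    IsElementary ρ.range := by
  choose α hα using fun i => toPSL_surjective (ρ (π (FreeGroup.of i)))
  have hlift : ρ.comp π = toPSL.comp (FreeGroup.lift α) :=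
    FreeGroup.ext_hom _ _ fun i => by simp [hα]
  have hsub : Subsingleton (Fin n) := Fin.subsingleton_iff_le_one.mpr hn
  obtain ⟨z, hz⟩ : ∃ z : OnePoint ℂ, ∀ i, (α i : GL (Fin 2) ℂ) • z = z := by
    rcases isEmpty_or_nonempty (Fin n) with h | ⟨⟨i⟩⟩
    · exact ⟨OnePoint.infty, fun i => h.elim i⟩
    · obtain ⟨z, hz⟩ := exists_fixedPoint (α i)
      exact ⟨z, fun j => by rwa [Subsingleton.elim j i]⟩
  have hw : ∀ w, (FreeGroup.lift α w : GL (Fin 2) ℂ) • z = z := by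
    intro w
    induction w using FreeGroup.induction_on with
    | C1 => rw [map_one, map_one, one_smul]
    | of i => rw [FreeGroup.lift_apply_of]; exact hz i
    | inv_of i h => rw [map_inv, map_inv, inv_smul_eq_iff, h]
    | mul x y hx hy => rw [map_mul, map_mul, mul_smul, hy, hx]
  refine ⟨z, (Set.finite_singleton z).subset ?_⟩
  rintro _ ⟨C, ⟨g, hg⟩, rfl⟩
  obtain ⟨w, rfl⟩ := hπ g
  have h1 : toPSL (FreeGroup.lift α w) = toPSL C := by
    rw [← hg]
    exact (DFunLike.congr_fun hlift w).symm
  rw [Set.mem_singleton_iff]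
  rcases (toPSL_eq_toPSL_iff _ _).mp h1.symm with h | h
  · rw [Subtype.ext h, hw]
  · rw [smul_eq_of_eq_neg h, hw]

/-- The number of relators is dropped: the Bézout bound depends only on the number of variables and
the degree. -/
theorem HasPresentationBounds.exists_surjective {G : Type*} [Group G] {n m l : ℕ}
    (hG : HasPresentationBounds G n m l) : ∃ k ≤ n, ∃ (rels : Set (FreeGroup (Fin k)))
      (π : FreeGroup (Fin k) →* G), (∀ r ∈ rels, r.norm ≤ l) ∧ Function.Surjective π ∧
      (∀ r ∈ rels, π r = 1) ∧ ∀ (H : Type) [Group H] (φ : FreeGroup (Fin k) →* H),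
        (∀ r ∈ rels, φ r = 1) → ∃ ρ : G →* H, ρ.comp π = φ := by
  obtain ⟨k, hk, rels, -, hlen, ⟨e⟩⟩ := hG
  refine ⟨k, hk, rels, e.toMonoidHom.comp (PresentedGroup.mk _), fun r hr => hlen r hr,
    e.surjective.comp (PresentedGroup.mk_surjective _), fun r hr => ?_, fun H _ φ hφ => ?_⟩
  · have : PresentedGroup.mk (rels : Set (FreeGroup (Fin k))) r = 1 :=
      PresentedGroup.one_of_mem hr
    rw [MonoidHom.comp_apply, this, map_one]
  · have hφ' : FreeGroup.lift (fun i => φ (FreeGroup.of i)) = φ :=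
      FreeGroup.ext_hom _ _ fun i => by simp
    have h : ∀ r ∈ (rels : Set (FreeGroup (Fin k))),
        FreeGroup.lift (fun i => φ (FreeGroup.of i)) r = 1 := by rwa [hφ']
    refine ⟨(PresentedGroup.toGroup h).comp e.symm.toMonoidHom, ?_⟩
    refine FreeGroup.ext_hom _ _ fun i => ?_
    have h1 : e.symm (e (PresentedGroup.mk (rels : Set (FreeGroup (Fin k))) (FreeGroup.of i))) =
        PresentedGroup.of i := e.symm_apply_apply _
    change PresentedGroup.toGroup h (e.symm (e (PresentedGroup.mk _ (FreeGroup.of i)))) = _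
    rw [h1, PresentedGroup.toGroup.of]

theorem lemma4p2 {G : Type*} [Group G] (t : ℕ)
    (hG : HasPresentationBounds G (t + 1) (2 * t) 3)
    (X : Set (PSLCharacterVariety G))
    (hX : X ∈ irreducibleComponents (PSLCharacterVariety G))
    (hdim : topologicalKrullDim X = 0)
    (hne : ∀ ρ : G →* PSL(2, ℂ), PSLCharacterVariety.ofRep ρ ∈ X → ¬ IsElementary ρ.range)
    (ρ : G →* PSL(2, ℂ)) (hρ : PSLCharacterVariety.ofRep ρ ∈ X) :
    FiniteDimensional ℚ (traceField ρ.range) ∧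
      (Module.finrank ℚ (traceField ρ.range) : ℝ) ≤ (2 : ℝ) ^ ((t : ℤ) - 1) * 3 ^ (6 * t) := by
  obtain ⟨n, hn, rels, π, hlen, hπ, hπr, hker⟩ := hG.exists_surjective
  have hrank := rank_traceField_le_of_isolated hlen π hπ hπr (hker _) hX hdim hρ
  refine ⟨Module.rank_lt_aleph0_iff.mp (hrank.trans_lt (Cardinal.natCast_lt_aleph0)), ?_⟩
  -- For `t = 0` the claimed bound is `1 / 2`, so only the non-elementarity hypothesis can save the
  -- statement: one generator has a fixed point.
  rcases t with _ | t
  · exact absurd (isElementary_range_of_subsingleton hn π hπ ρ) (hne ρ hρ)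
  · have h1 : Module.finrank ℚ (traceField ρ.range) ≤ 2 ^ t * 3 ^ (6 * (t + 1)) := by
      calc Module.finrank ℚ (traceField ρ.range) ≤ 2 ^ (4 * n) :=
            Module.finrank_le_of_rank_le hrank
        _ ≤ 2 ^ (4 * (t + 1 + 1)) := Nat.pow_le_pow_right two_pos (by omega)
        _ = 256 * 16 ^ t := by
            rw [show 4 * (t + 1 + 1) = 8 + 4 * t by ring, pow_add, pow_mul]
            norm_num
        _ ≤ 729 * 1458 ^ t := Nat.mul_le_mul (by norm_num) (Nat.pow_le_pow_left (by norm_num) t)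
        _ = 2 ^ t * 3 ^ (6 * (t + 1)) := by
            rw [show (1458 : ℕ) = 2 * 3 ^ 6 by norm_num, mul_pow, ← pow_mul, mul_add, pow_add]
            ring
    have h2 : ((t + 1 : ℕ) : ℤ) - 1 = (t : ℤ) := by push_cast; ring
    rw [h2, zpow_natCast]
    exact_mod_cast h1

end
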